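/- Let $m,n\ge 1$ be integers and $\alpha\in(0,1/2)$. Then for every collection of real numbers $\Theta=\{\theta_{i,j}:1\le i\le m,\ 1\le j\le n\}$, with linear forms $L_j(\mathbf x)=\sum_{i=1}^m\theta_{i,j}x_i$ ($1\le j\le n$), the set $\mathcal B(\Theta)$ of all $\eta=(\eta_1,\dots,\eta_n)\in\mathbb R^n$ for which $$\inf_{\mathbf x\in\mathbb Z^m\setminus\{\mathbf 0\}}\Bigl(\max_{1\le j\le n}\|L_j(\mathbf x)-\eta_j\|\Bigr)^n\Bigl(\max_{1\le i\le m}|x_i|\Bigr)^m>0$$ is $\alpha$-winning in $\mathbb R^n$, where $\|t\|$ is the distance from $t\in\mathbb R$ to the nearest integer. Here $S\subseteq\mathbb R^n$ is called $\alpha$-winning if for every $\beta\in(0,1)$ White has a winning strategy in the following game of Schmidt, played with closed Euclidean balls. Black chooses a ball $B_0$ of any radius $\rho>0$; then, for $k=0,1,2,\dots$, White chooses a ball $W_k\subseteq B_k$ of radius $\alpha(\alpha\beta)^k\rho$, and Black chooses a ball $B_{k+1}\subseteq W_k$ of radius $(\alpha\beta)^{k+1}\rho$. White wins if the unique point of $\bigcap_k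 B_k$ lies in $S$. -/

import Mathlib

/-- Distance from a real number to the nearest integer. -/
noncomputable def distNearestInt (t : ℝ) : ℝ := |t - (round t : ℝ)|

/-- The linear form `L_j(x) = ∑ i, θ_{i,j} x_i` in integer variables. -/
noncomputable def linForm {m n : ℕ} (Θ : Matrix (Fin m) (Fin n) ℝ) (j : Fin n)
    (x : Fin m → ℤ) : ℝ :=
  ∑ i, Θ i j * (x i : ℝ)

/-- The set `B(Θ)` of all `η ∈ ℝⁿ` with
`inf_{x ≠ 0} (max_j ‖L_j(x) - η_j‖)^n (max_i |x_i|)^m > 0`. Used for `m, n ≥ 1`, where the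
suprema are maxima over nonempty finite sets and the infimum is that of a nonempty family of
nonnegative numbers. -/
def badAffine {m n : ℕ} (Θ : Matrix (Fin m) (Fin n) ℝ) : Set (EuclideanSpace ℝ (Fin n)) :=
  {η | 0 < ⨅ x : {x : Fin m → ℤ // x ≠ 0},
      (⨆ j : Fin n, distNearestInt (linForm Θ j x.1 - η j)) ^ n *
        (⨆ i : Fin m, |(x.1 i : ℝ)|) ^ m}

namespace SchmidtGame

variable {E : Type*} [NormedAddCommGroup E] [NormedSpace ℝ E]

/-- A strategy of White: from the radius of the initial ball and the list of the centres of
Black's balls `B_0, …, B_k` it computes the centre of White's ball `W_k`. All other data of the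
position (the remaining radii, White's earlier balls) are determined by these. -/
abbrev Strategy (E : Type*) := ℝ → List E → E

/-- Black's `k`-th ball, of radius `(αβ)^k ρ`, when Black plays the centres `b 0, b 1, …`. -/
def blackBall (α β ρ : ℝ) (b : ℕ → E) (k : ℕ) : Set E :=
  Metric.closedBall (b k) ((α * β) ^ k * ρ)

/-- White's `k`-th ball, of radius `α (αβ)^k ρ`, the answer of the strategy `σ` to
`B_0, …, B_k`. -/
def whiteBall (α β ρ : ℝ) (σ : Strategy E) (b : ℕ → E) (k : ℕ) : Set E :=
  Metric.closedBall (σ ρ ((List.range (k + 1)).map b)) (α * ((α * β) ^ k * ρ))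

/-- `S` is `(α, β)`-winning: White has a strategy such that, whatever initial ball Black chooses
and however Black plays,
* White's moves obey the rule `W_k ⊆ B_k` as long as Black's moves have obeyed `B_{i+1} ⊆ W_i`;
* if Black obeys the rules forever, the unique common point of the balls lies in `S`. -/
def IsWinningFor (α β : ℝ) (S : Set E) : Prop :=
  ∃ σ : Strategy E, ∀ ρ : ℝ, 0 < ρ → ∀ b : ℕ → E,
    (∀ k, (∀ i < k, blackBall α β ρ b (i + 1) ⊆ whiteBall α β ρ σ b i) →
      whiteBall α β ρ σ b k ⊆ blackBall α β ρ b k) ∧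
    ((∀ i, blackBall α β ρ b (i + 1) ⊆ whiteBall α β ρ σ b i) →
      ∃ x ∈ S, ⋂ k, blackBall α β ρ b k = {x})

/-- `S` is `α`-winning: it is `(α, β)`-winning for every `β ∈ (0, 1)`. -/
def IsAlphaWinning (α : ℝ) (S : Set E) : Prop :=
  ∀ β : ℝ, 0 < β → β < 1 → IsWinningFor α β S

end SchmidtGame

/-!
The proof is a transference argument. For `u ∈ ℤⁿ` let `M_i(u) = ∑ j, θ_{i,j} u_j` be the
transposed forms. The identity
`∑ j, u_j η_j = ∑ i, x_i M_i(u) - ∑ j, u_j (L_j(x) - η_j)`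
bounds `‖⟨u, η⟩‖` by `m max|x_i| max‖M_i(u)‖ + n max|u_j| max‖L_j(x) - η_j‖`. By
Dirichlet's theorem there is, for each `x`, a `u` for which the first summand is small while
`max|u_j| ^ n ≪ max|x_i| ^ m`. If `‖⟨u, η⟩‖` is bounded below for all the `u` used in this way,
then `η ∈ B(Θ)` (`mem_badAffine_of_le_distNearestInt`).

White therefore has to keep `η` away from the hyperplanes `⟨u, η⟩ ∈ ℤ`. When the current ball has
radius comparable with, but smaller than, the distance between these hyperplanes, a single move
does this for one given `u`, because `α < 1 / 2`
(`SchmidtGame.exists_move_avoiding_hyperplanes`). What makes the strategy work is that one vector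
per move suffices: put `R = (αβ)⁻¹`, the ratio of successive radii, and keep in each window
`R ^ (j - 1) < max|u_i| ≤ R ^ j` only one vector with `max‖M_i(u)‖` least
(`exists_lacunary_approximations`). The vector which Dirichlet's theorem gives may then be
replaced by the one kept in its window, which is less than `R` times as long. The windows are in
step with the moves of the game.
-/

/-! ### Distance to the nearest integer -/

theorem distNearestInt_eq_norm (t : ℝ) : distNearestInt t = ‖(t : UnitAddCircle)‖ :=
  (UnitAddCircle.norm_eq).symm

theorem distNearestInt_nonneg (t : ℝ) : 0 ≤ distNearestInt t := abs_nonneg _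

theorem distNearestInt_le (t : ℝ) (z : ℤ) : distNearestInt t ≤ |t - z| := round_le t z

theorem distNearestInt_sub_le (s t : ℝ) :
    distNearestInt (s - t) ≤ distNearestInt s + distNearestInt t := by
  simp only [distNearestInt_eq_norm, AddCircle.coe_sub]
  exact norm_sub_le _ _

theorem distNearestInt_sum_mul_le {ι : Type*} (s : Finset ι) (k : ι → ℤ) (t : ι → ℝ) :
    distNearestInt (∑ i ∈ s, (k i : ℝ) * t i) ≤ ∑ i ∈ s, |(k i : ℝ)| * distNearestInt (t i) := by
  have h : ((∑ i ∈ s, (k i : ℝ) * t i : ℝ) : UnitAddCircle) =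
      ∑ i ∈ s, k i • (t i : UnitAddCircle) := by
    simp only [← zsmul_eq_mul]
    exact (map_sum (QuotientAddGroup.mk' (AddSubgroup.zmultiples (1 : ℝ))) _ _)
  simp only [distNearestInt_eq_norm, h]
  refine (norm_sum_le _ _).trans (Finset.sum_le_sum fun i _ => ?_)
  exact (norm_zsmul_le _ _).trans (by simp [Int.norm_eq_abs])

theorem le_distNearestInt_of_mem_Icc {t δ : ℝ} {p : ℤ} (h₁ : p + δ ≤ t) (h₂ : t ≤ p + 1 - δ) :
    δ ≤ distNearestInt t := by
  unfold distNearestInt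
  rcases le_or_gt (round t) p with h | h
  · have : ((round t : ℤ) : ℝ) ≤ p := by exact_mod_cast h
    exact le_abs.2 (Or.inl (by linarith))
  · have : (p : ℝ) + 1 ≤ (round t : ℤ) := by exact_mod_cast h
    exact le_abs.2 (Or.inr (by linarith))

/-! ### Positional strategies in Schmidt's game -/

namespace SchmidtGame

theorem iInter_closedBall_eq_singleton {E : Type*} [NormedAddCommGroup E] [ProperSpace E]
    {b : ℕ → E} {r : ℕ → ℝ} (hr : ∀ k, 0 ≤ r k) (hlim : Filter.Tendsto r Filter.atTop (nhds 0))
    (hsub : ∀ k, Metric.closedBall (b (k + 1)) (r (k + 1)) ⊆ Metric.closedBall (b k) (r k)) :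
    ∃ x, ⋂ k, Metric.closedBall (b k) (r k) = {x} := by
  obtain ⟨x, hx⟩ := IsCompact.nonempty_iInter_of_sequence_nonempty_isCompact_isClosed
    (fun k => Metric.closedBall (b k) (r k)) hsub
    (fun k => ⟨b k, Metric.mem_closedBall_self (hr k)⟩) (isCompact_closedBall _ _)
    (fun _ => Metric.isClosed_closedBall)
  refine ⟨x, Set.Subset.antisymm (fun y hy => ?_) (Set.singleton_subset_iff.2 hx)⟩
  rw [Set.mem_iInter] at hx hy
  refine Set.mem_singleton_iff.2 (dist_le_zero.1 ?_)
  refine ge_of_tendsto' (by simpa using hlim.add hlim) fun k => ?_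
  exact (dist_triangle_right y x (b k)).trans (add_le_add (hy k) (hx k))

/-- To win it is enough for White to answer `B_k` by a rule `f` depending only on the initial
radius, on `k` and on the centre of `B_k`: the bound `hf` makes the answer legal, and every
point common to all of White's balls has to lie in `S`. -/
theorem isWinningFor_of_move {E : Type*} [NormedAddCommGroup E] [NormedSpace ℝ E] [ProperSpace E]
    {α β : ℝ} {S : Set E} (hα0 : 0 < α) (hα1 : α < 1) (hβ0 : 0 < β) (hβ1 : β < 1)
    (f : ℝ → ℕ → E → E)
    (hf : ∀ ρ, 0 < ρ → ∀ k c, dist (f ρ k c) c ≤ (1 - α) * ((α * β) ^ k * ρ))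
    (hS : ∀ ρ, 0 < ρ → ∀ (b : ℕ → E) (x : E),
      (∀ k, x ∈ Metric.closedBall (f ρ k (b k)) (α * ((α * β) ^ k * ρ))) → x ∈ S) :
    IsWinningFor α β S := by
  refine ⟨fun ρ l => f ρ (l.length - 1) (l.getLastD 0), fun ρ hρ b => ?_⟩
  have hW : ∀ k, whiteBall α β ρ (fun ρ l => f ρ (l.length - 1) (l.getLastD 0)) b k =
      Metric.closedBall (f ρ k (b k)) (α * ((α * β) ^ k * ρ)) := fun k => by
    simp [whiteBall, List.range_succ]
  have hWB : ∀ k, whiteBall α β ρ (fun ρ l => f ρ (l.length - 1) (l.getLastD 0)) b k ⊆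
      blackBall α β ρ b k := fun k => by
    rw [hW]
    exact Metric.closedBall_subset_closedBall' (by linarith [hf ρ hρ k (b k)])
  refine ⟨fun k _ => hWB k, fun hB => ?_⟩
  have hαβ : α * β < 1 := by nlinarith
  obtain ⟨x, hx⟩ := iInter_closedBall_eq_singleton (b := b) (r := fun k => (α * β) ^ k * ρ)
    (fun k => by positivity)
    (by simpa using (tendsto_pow_atTop_nhds_zero_of_lt_one (by positivity) hαβ).mul_const ρ)
    (fun k => (hB k).trans (hWB k))
  refine ⟨x, hS ρ hρ b x fun k => ?_, hx⟩
  have hxk : x ∈ blackBall α β ρ b (k + 1) :=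
    Set.mem_iInter.1 (hx.ge (Set.mem_singleton x)) (k + 1)
  exact hW k ▸ hB k hxk

/-- Since `α < 1 / 2`, the ball of radius `α r` pushed to the boundary of the given ball of radius
`r` in the direction `±u` does not reach back to the hyperplane through the centre orthogonal to
`u`. So a single move avoids a neighbourhood of all the hyperplanes `⟪u, y⟫ ∈ ℤ`, when these
are far apart compared with `r`. -/
theorem exists_move_avoiding_hyperplanes {E : Type*} [NormedAddCommGroup E]
    [InnerProductSpace ℝ E] {α r : ℝ} (hα0 : 0 < α) (hα : α < 1 / 2) (hr : 0 < r) {u : E}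
    (hu : u ≠ 0) (hur : r * ‖u‖ ≤ 1 / 4) (c : E) :
    ∃ c', dist c' c ≤ (1 - α) * r ∧ ∀ y ∈ Metric.closedBall c' (α * r),
      (1 - 2 * α) * (r * ‖u‖) ≤ distNearestInt (inner ℝ u y) := by
  have hu' : 0 < ‖u‖ := norm_pos_iff.2 hu
  have hru : 0 < r * ‖u‖ := by positivity
  have key : ∀ s : ℝ, ∀ y ∈ Metric.closedBall (c + (s * ((1 - α) * r / ‖u‖)) • u) (α * r),
      |inner ℝ u y - inner ℝ u c - s * ((1 - α) * (r * ‖u‖))| ≤ α * (r * ‖u‖) := by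
    intro s y hy
    have h1 : inner ℝ u (y - (c + (s * ((1 - α) * r / ‖u‖)) • u)) =
        inner ℝ u y - inner ℝ u c - s * ((1 - α) * (r * ‖u‖)) := by
      rw [inner_sub_right, inner_add_right, inner_smul_right, real_inner_self_eq_norm_sq]
      field_simp
      ring
    rw [← h1]
    refine (abs_real_inner_le_norm _ _).trans ?_
    rw [mem_closedBall_iff_norm] at hy
    nlinarith
  have hdist : ∀ s : ℝ, |s| = 1 → dist (c + (s * ((1 - α) * r / ‖u‖)) • u) c ≤ (1 - α) * r := by
    intro s hs
    have h0 : 0 ≤ (1 - α) * r := by nlinarith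
    rw [dist_self_add_left, norm_smul, Real.norm_eq_abs, abs_mul, hs,
      abs_of_nonneg (by positivity)]
    exact (by field_simp : 1 * ((1 - α) * r / ‖u‖) * ‖u‖ = (1 - α) * r).le
  have hround := abs_le.1 (abs_sub_round (inner ℝ u c))
  rcases le_total ((round (inner ℝ u c) : ℤ) : ℝ) (inner ℝ u c) with h | h
  · refine ⟨_, hdist 1 (by simp), fun y hy => ?_⟩
    have := abs_le.1 (key 1 y hy)
    exact le_distNearestInt_of_mem_Icc (p := round (inner ℝ u c)) (by nlinarith) (by nlinarith)
  · refine ⟨_, hdist (-1) (by simp), fun y hy => ?_⟩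
    have := abs_le.1 (key (-1) y hy)
    exact le_distNearestInt_of_mem_Icc (p := round (inner ℝ u c) - 1)
      (by push_cast; nlinarith) (by push_cast; nlinarith)

end SchmidtGame

/-! ### Integer vectors making the transposed forms small -/

theorem abs_coe_le_norm {ι : Type*} [Fintype ι] (u : ι → ℤ) (i : ι) : |(u i : ℝ)| ≤ ‖u‖ := by
  simpa [Int.norm_eq_abs] using norm_le_pi_norm u i

theorem one_le_norm_of_ne_zero {ι : Type*} [Fintype ι] {u : ι → ℤ} (hu : u ≠ 0) : 1 ≤ ‖u‖ := by
  obtain ⟨i, hi⟩ := Function.ne_iff.1 hu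
  refine le_trans ?_ (abs_coe_le_norm u i)
  exact_mod_cast Int.one_le_abs hi

/-- **Dirichlet's theorem** on simultaneous approximation, by the pigeonhole principle. -/
theorem exists_distNearestInt_linForm_le {m n : ℕ} (Θ : Matrix (Fin m) (Fin n) ℝ) {N T : ℕ}
    (hT : 0 < T) (h : T ^ n < (N + 1) ^ m) :
    ∃ u : Fin m → ℤ, u ≠ 0 ∧ ‖u‖ ≤ N ∧ ∀ j, distNearestInt (linForm Θ j u) ≤ 1 / T := by
  have hT' : (0 : ℝ) < T := by exact_mod_cast hT
  let L : (Fin m → Fin (N + 1)) → Fin n → ℝ := fun w j => linForm Θ j fun i => ((w i : ℕ) : ℤ)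
  let box : (Fin m → Fin (N + 1)) → Fin n → ℕ := fun w j => ⌊T * Int.fract (L w j)⌋₊
  obtain ⟨w, -, w', -, hne, hbox⟩ := Finset.exists_ne_map_eq_of_card_lt_of_maps_to
    (s := Finset.univ) (t := Fintype.piFinset fun _ : Fin n => Finset.range T) (f := box)
    (by simpa using h) (fun w _ => by
      simp only [Finset.mem_coe, Fintype.mem_piFinset, Finset.mem_range, box]
      intro j
      rw [Nat.floor_lt (by have := Int.fract_nonneg (L w j); positivity)]
      nlinarith [Int.fract_lt_one (L w j)])
  refine ⟨fun i => ((w i : ℕ) : ℤ) - ((w' i : ℕ) : ℤ), fun h0 => hne ?_, ?_, fun j => ?_⟩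
  · ext i
    have := congrFun h0 i
    simp only [Pi.zero_apply] at this
    omega
  · refine (pi_norm_le_iff_of_nonneg (by positivity)).2 fun i => ?_
    rw [Int.norm_eq_abs]
    have h1 := (w i).is_lt
    have h2 := (w' i).is_lt
    have h3 : |((w i : ℕ) : ℤ) - ((w' i : ℕ) : ℤ)| ≤ N := by rw [abs_le]; omega
    exact_mod_cast h3
  · have hL : linForm Θ j (fun i => ((w i : ℕ) : ℤ) - ((w' i : ℕ) : ℤ)) = L w j - L w' j := by
      simp [L, linForm, mul_sub, Finset.sum_sub_distrib]
    have hj : ⌊T * Int.fract (L w j)⌋₊ = ⌊T * Int.fract (L w' j)⌋₊ := congrFun hbox j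
    have h0 := Int.fract_nonneg (L w j)
    have h0' := Int.fract_nonneg (L w' j)
    have h1 := Nat.floor_le (a := T * Int.fract (L w j)) (by positivity)
    have h2 := Nat.lt_floor_add_one (T * Int.fract (L w j))
    have h1' := Nat.floor_le (a := T * Int.fract (L w' j)) (by positivity)
    have h2' := Nat.lt_floor_add_one (T * Int.fract (L w' j))
    rw [hj] at h1 h2
    refine (distNearestInt_le _ (⌊L w j⌋ - ⌊L w' j⌋)).trans ?_
    have h3 : linForm Θ j (fun i => ((w i : ℕ) : ℤ) - ((w' i : ℕ) : ℤ)) -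
        ((⌊L w j⌋ - ⌊L w' j⌋ : ℤ) : ℝ) = Int.fract (L w j) - Int.fract (L w' j) := by
      rw [hL, Int.fract, Int.fract]
      push_cast
      ring
    rw [h3, abs_le, ← neg_div, div_le_iff₀ hT', le_div_iff₀ hT']
    constructor <;> nlinarith

/-- In each window `R ^ j < R * ‖u‖ ≤ R * R ^ j` choose a vector `v j` making
`max_i ‖L_i(u)‖` least. These vectors are as good as all integer vectors for the purposes of
Dirichlet's theorem, and there is only one of them per window. -/
theorem exists_lacunary_approximations {m n : ℕ} (hm : 0 < m) (Θ : Matrix (Fin m) (Fin n) ℝ)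
    {R : ℝ} (hR : 2 ≤ R) :
    ∃ v : ℕ → Fin m → ℤ, (∀ j, R ^ j < R * ‖v j‖) ∧ (∀ j, ‖v j‖ ≤ R ^ j) ∧
      ∀ j T : ℕ, 0 < T → (T : ℝ) ^ n ≤ (R ^ j) ^ m →
        ∃ i ≤ j, ∀ a, distNearestInt (linForm Θ a (v i)) ≤ 1 / T := by
  let Z : (Fin m → ℤ) → ℝ := fun u => ‖fun a => distNearestInt (linForm Θ a u)‖
  have hex : ∀ j : ℕ, ∃ v : Fin m → ℤ, R ^ j < R * ‖v‖ ∧ ‖v‖ ≤ R ^ j ∧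
      ∀ u : Fin m → ℤ, R ^ j < R * ‖u‖ → ‖u‖ ≤ R ^ j → Z v ≤ Z u := by
    intro j
    let s : Set (Fin m → ℤ) := {u | R ^ j < R * ‖u‖ ∧ ‖u‖ ≤ R ^ j}
    have hfin : s.Finite := by
      refine (isCompact_closedBall (0 : Fin m → ℤ) (R ^ j)).finite_of_discrete.subset ?_
      intro u hu
      simpa using hu.2
    have hne : s.Nonempty := by
      have : Nonempty (Fin m) := ⟨⟨0, hm⟩⟩
      have h1 : (1 : ℝ) ≤ ⌊R ^ j⌋₊ :=
        Nat.one_le_cast.2 ((Nat.one_le_floor_iff _).2 (one_le_pow₀ (by linarith)))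
      have h2 := Nat.lt_floor_add_one (R ^ j)
      have h3 : ‖fun _ : Fin m => (⌊R ^ j⌋₊ : ℤ)‖ = ⌊R ^ j⌋₊ := by
        rw [pi_norm_const, Int.norm_natCast]
      refine ⟨fun _ => (⌊R ^ j⌋₊ : ℤ), ?_, ?_⟩
      · rw [h3]
        nlinarith
      · rw [h3]
        exact Nat.floor_le (by positivity)
    obtain ⟨v, hv, hmin⟩ := Set.exists_min_image s Z hfin hne
    exact ⟨v, hv.1, hv.2, fun u h1 h2 => hmin u ⟨h1, h2⟩⟩
  choose v hv1 hv2 hv3 using hex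
  refine ⟨v, hv1, hv2, fun j T hT hTj => ?_⟩
  have hRj : 0 ≤ R ^ j := by positivity
  obtain ⟨u, hu0, huN, hu⟩ := exists_distNearestInt_linForm_le Θ (N := ⌊R ^ j⌋₊) hT (by
    have h1 : (R ^ j) ^ m < ((⌊R ^ j⌋₊ : ℝ) + 1) ^ m :=
      pow_lt_pow_left₀ (Nat.lt_floor_add_one _) hRj hm.ne'
    exact_mod_cast hTj.trans_lt h1)
  have huj : ‖u‖ ≤ R ^ j := huN.trans (Nat.floor_le hRj)
  have hex' : ∃ i, ‖u‖ ≤ R ^ i := ⟨j, huj⟩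
  classical
  refine ⟨Nat.find hex', Nat.find_min' hex' huj, fun a => ?_⟩
  have hlow : R ^ Nat.find hex' < R * ‖u‖ := by
    rcases Nat.eq_zero_or_pos (Nat.find hex') with h0 | h0
    · rw [h0, pow_zero]
      nlinarith [one_le_norm_of_ne_zero hu0]
    · have := not_le.1 (Nat.find_min hex' (Nat.sub_lt h0 one_pos))
      calc R ^ Nat.find hex' = R * R ^ (Nat.find hex' - 1) := by
            rw [← pow_succ', Nat.sub_add_cancel h0]
        _ < R * ‖u‖ := by gcongr
  have hZ := hv3 _ u hlow (Nat.find_spec hex')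
  have h1 : distNearestInt (linForm Θ a (v (Nat.find hex'))) ≤ Z (v (Nat.find hex')) :=
    (le_abs_self _).trans (norm_le_pi_norm
      (fun a => distNearestInt (linForm Θ a (v (Nat.find hex')))) a)
  refine (h1.trans hZ).trans ((pi_norm_le_iff_of_nonneg (by positivity)).2 fun a => ?_)
  rw [Real.norm_eq_abs, abs_of_nonneg (distNearestInt_nonneg _)]
  exact hu a

/-! ### Transference -/

theorem distNearestInt_sum_mul_le_transpose {m n : ℕ} (Θ : Matrix (Fin m) (Fin n) ℝ)
    (x : Fin m → ℤ) (u : Fin n → ℤ) (η : Fin n → ℝ) :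
    distNearestInt (∑ j, (u j : ℝ) * η j) ≤
      ∑ i, |(x i : ℝ)| * distNearestInt (linForm Θ.transpose i u) +
        ∑ j, |(u j : ℝ)| * distNearestInt (linForm Θ j x - η j) := by
  have h : ∑ j, (u j : ℝ) * η j = ∑ i, (x i : ℝ) * linForm Θ.transpose i u -
      ∑ j, (u j : ℝ) * (linForm Θ j x - η j) := by
    simp only [linForm, mul_sub, Finset.sum_sub_distrib, Finset.mul_sum, Matrix.transpose_apply]
    rw [Finset.sum_comm]
    rw [Finset.sum_congr rfl fun j _ => Finset.sum_congr rfl fun i _ =>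
      (by ring : (x i : ℝ) * (Θ i j * (u j : ℝ)) = (u j : ℝ) * (Θ i j * (x i : ℝ)))]
    ring
  rw [h]
  exact (distNearestInt_sub_le _ _).trans
    (add_le_add (distNearestInt_sum_mul_le _ _ _) (distNearestInt_sum_mul_le _ _ _))

/-- If `‖⟨v_j, η⟩‖` is bounded below along a sequence of integer vectors which, up to each scale
`R ^ j`, satisfies Dirichlet's theorem for the transposed forms, then `η ∈ B(Θ)`. -/
theorem mem_badAffine_of_le_distNearestInt {m n : ℕ} (hm : 0 < m) (hn : 0 < n)
    (Θ : Matrix (Fin m) (Fin n) ℝ) {R c : ℝ} (hR : 1 < R) (hc : 0 < c) {v : ℕ → Fin n → ℤ}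
    (hv : ∀ j, ‖v j‖ ≤ R ^ j)
    (hdir : ∀ j T : ℕ, 0 < T → (T : ℝ) ^ m ≤ (R ^ j) ^ n →
      ∃ i ≤ j, ∀ a, distNearestInt (linForm Θ.transpose a (v i)) ≤ 1 / T)
    (η : EuclideanSpace ℝ (Fin n)) (hη : ∀ j, c ≤ distNearestInt (∑ a, (v j a : ℝ) * η a)) :
    η ∈ badAffine Θ := by
  have hm' : (0 : ℝ) < m := by exact_mod_cast hm
  have hn' : (0 : ℝ) < n := by exact_mod_cast hn
  have hR0 : 0 < R := by linarith
  set K : ℝ := 2 * m / c + 1 with hK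
  have hK0 : 0 < K := by positivity
  have : Nonempty {x : Fin m → ℤ // x ≠ 0} :=
    ⟨fun _ => 1, fun h => one_ne_zero (congrFun h ⟨0, hm⟩)⟩
  refine lt_of_lt_of_le (by positivity : 0 < (c / (2 * n)) ^ n / (R ^ n * K ^ m))
    (le_ciInf fun ⟨x, hx⟩ => ?_)
  dsimp only
  set D : ℝ := ⨆ j : Fin n, distNearestInt (linForm Θ j x - η j) with hD
  set X : ℝ := ⨆ i : Fin m, |(x i : ℝ)| with hXdef
  have hDj : ∀ j, distNearestInt (linForm Θ j x - η j) ≤ D := fun j =>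
    le_ciSup (f := fun j => distNearestInt (linForm Θ j x - η j))
      (Set.finite_range _).bddAbove j
  have hXi : ∀ i, |(x i : ℝ)| ≤ X := fun i =>
    le_ciSup (f := fun i => |(x i : ℝ)|) (Set.finite_range _).bddAbove i
  have hD0 : 0 ≤ D := (distNearestInt_nonneg _).trans (hDj ⟨0, hn⟩)
  have hX1 : 1 ≤ X := by
    obtain ⟨i, hi⟩ := Function.ne_iff.1 hx
    exact le_trans (by exact_mod_cast Int.one_le_abs hi) (hXi i)
  -- `T` is large enough for the terms `x_i L_i(u)` to contribute at most `c / 2`.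
  set T : ℕ := ⌈2 * m * X / c⌉₊ with hTdef
  have hT1 : 2 * m * X / c ≤ T := Nat.le_ceil _
  have hT0 : 0 < T := Nat.ceil_pos.2 (by positivity)
  have hT0' : (0 : ℝ) < T := by exact_mod_cast hT0
  have hTK : (T : ℝ) ≤ K * X := by
    have h1 := (Nat.ceil_lt_add_one (by positivity : 0 ≤ 2 * m * X / c)).le
    have h2 : K * X = 2 * m * X / c + X := by rw [hK]; ring
    linarith
  have hex : ∃ j : ℕ, (T : ℝ) ^ m ≤ (R ^ j) ^ n := by
    obtain ⟨j, hj⟩ := pow_unbounded_of_one_lt ((T : ℝ) ^ m) hR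
    exact ⟨j, hj.le.trans (le_self_pow₀ (one_le_pow₀ hR.le) hn.ne')⟩
  classical
  set j := Nat.find hex with hj
  have hjub : (R ^ j) ^ n ≤ R ^ n * (T : ℝ) ^ m := by
    have hT1 : (1 : ℝ) ≤ (T : ℝ) ^ m := one_le_pow₀ (by exact_mod_cast hT0)
    rcases Nat.eq_zero_or_pos j with h0 | h0
    · rw [h0, pow_zero, one_pow]
      exact one_le_mul_of_one_le_of_one_le (one_le_pow₀ hR.le) hT1
    · have h1 := not_le.1 (Nat.find_min hex (Nat.sub_lt h0 one_pos))
      calc (R ^ j) ^ n = R ^ n * (R ^ (j - 1)) ^ n := by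
            rw [← mul_pow, ← pow_succ', Nat.sub_add_cancel h0]
        _ ≤ R ^ n * (T : ℝ) ^ m := by gcongr
  obtain ⟨i, hij, hi⟩ := hdir j T hT0 (Nat.find_spec hex)
  have hvi : ‖v i‖ ≤ R ^ j := (hv i).trans (pow_le_pow_right₀ hR.le hij)
  have hmain : c ≤ m * (X * (1 / T)) + n * (R ^ j * D) := by
    refine (hη i).trans ((distNearestInt_sum_mul_le_transpose Θ x (v i) η).trans ?_)
    refine add_le_add ?_ ?_
    · refine (Finset.sum_le_card_nsmul _ _ (X * (1 / T)) fun a _ => ?_).trans (by simp)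
      exact mul_le_mul (hXi a) (hi a) (distNearestInt_nonneg _) (by linarith)
    · refine (Finset.sum_le_card_nsmul _ _ (R ^ j * D) fun a _ => ?_).trans (by simp)
      exact mul_le_mul ((abs_coe_le_norm _ _).trans hvi) (hDj a) (distNearestInt_nonneg _)
        (by positivity)
  have hhalf : m * (X * (1 / T)) ≤ c / 2 := by
    rw [div_le_iff₀ hc] at hT1
    rw [← mul_assoc, mul_one_div, div_le_iff₀ hT0']
    linarith
  have hcD : c / (2 * n) ≤ R ^ j * D := by
    rw [div_le_iff₀ (by positivity)]
    linarith
  rw [div_le_iff₀ (by positivity)]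
  calc (c / (2 * n)) ^ n ≤ (R ^ j * D) ^ n := by gcongr
    _ = (R ^ j) ^ n * D ^ n := mul_pow _ _ _
    _ ≤ R ^ n * (K * X) ^ m * D ^ n := by
        gcongr
        exact hjub.trans (by gcongr)
    _ = D ^ n * X ^ m * (R ^ n * K ^ m) := by rw [mul_pow]; ring

/-! ### The winning strategy -/

theorem norm_le_norm_toLp {n : ℕ} (u : Fin n → ℤ) :
    ‖u‖ ≤ ‖(WithLp.toLp 2 fun j => (u j : ℝ) : EuclideanSpace ℝ (Fin n))‖ := by
  refine (pi_norm_le_iff_of_nonneg (norm_nonneg _)).2 fun i => ?_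
  have := PiLp.norm_apply_le (WithLp.toLp 2 fun j => (u j : ℝ) : EuclideanSpace ℝ (Fin n)) i
  simpa [Int.norm_eq_abs] using this

theorem norm_toLp_le {n : ℕ} (u : Fin n → ℤ) :
    ‖(WithLp.toLp 2 fun j => (u j : ℝ) : EuclideanSpace ℝ (Fin n))‖ ≤ n * ‖u‖ := by
  rw [EuclideanSpace.norm_eq]
  refine Real.sqrt_le_iff.2 ⟨by positivity, ?_⟩
  refine (Finset.sum_le_card_nsmul _ _ (‖u‖ ^ 2) fun j _ => ?_).trans ?_
  · simpa using pow_le_pow_left₀ (abs_nonneg _) (abs_coe_le_norm u j) 2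
  · rw [Finset.card_univ, Fintype.card_fin, nsmul_eq_mul, mul_pow]
    gcongr
    exact_mod_cast Nat.le_self_pow two_ne_zero n

theorem theorem1 (α : ℝ) (hα0 : 0 < α) (hα : α < 1 / 2) (m n : ℕ) (hm : 0 < m) (hn : 0 < n)
    (Θ : Matrix (Fin m) (Fin n) ℝ) :
    SchmidtGame.IsAlphaWinning α (badAffine Θ) := by
  intro β hβ0 hβ1
  have hq0 : 0 < α * β := by positivity
  have hR : 2 ≤ (α * β)⁻¹ := by
    rw [le_inv_comm₀ two_pos hq0]
    nlinarith
  obtain ⟨v, hv1, hv2, hdir⟩ := exists_lacunary_approximations hn Θ.transpose hR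
  let w : ℕ → EuclideanSpace ℝ (Fin n) := fun j => WithLp.toLp 2 fun a => (v j a : ℝ)
  -- In the units of the game, the vector of the `j`-th window has length about `(α * β) ^ (-j)`.
  have hw1 : ∀ j, α * β < (α * β) ^ j * ‖w j‖ := fun j => by
    have h := (hv1 j).trans_le
      (mul_le_mul_of_nonneg_left (norm_le_norm_toLp (v j)) (by positivity))
    rw [inv_pow, inv_mul_eq_div, lt_div_iff₀ hq0, inv_mul_lt_iff₀ (by positivity)] at h
    exact h
  have hw2 : ∀ j, (α * β) ^ j * ‖w j‖ ≤ n := fun j => by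
    have h := (norm_toLp_le (v j)).trans (mul_le_mul_of_nonneg_left (hv2 j) (by positivity))
    rw [inv_pow, ← div_eq_mul_inv, le_div_iff₀ (by positivity), mul_comm] at h
    exact h
  have hn' : (0 : ℝ) < n := by exact_mod_cast hn
  -- White idles until move `k₀`, when the balls have become small compared with the gaps between
  -- the hyperplanes of the first window.
  have hk₀ : ∀ ρ : ℝ, ∃ k₀ : ℕ, 0 < ρ → (α * β) ^ k₀ * ρ * n ≤ 1 / 4 := fun ρ => by
    by_cases hρ : 0 < ρ
    · obtain ⟨k, hk⟩ := exists_pow_lt_of_lt_one (by positivity : 0 < 1 / (4 * (ρ * n)))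
        (by nlinarith : α * β < 1)
      rw [lt_div_iff₀ (by positivity)] at hk
      exact ⟨k, fun _ => by linarith⟩
    · exact ⟨0, fun h => absurd h hρ⟩
  choose k₀ hk₀ using hk₀
  have hmove : ∀ ρ k (c : EuclideanSpace ℝ (Fin n)), ∃ c', 0 < ρ →
      dist c' c ≤ (1 - α) * ((α * β) ^ k * ρ) ∧ ∀ j, k = k₀ ρ + j →
        ∀ y ∈ Metric.closedBall c' (α * ((α * β) ^ k * ρ)),
          (1 - 2 * α) * (((α * β) ^ k * ρ) * ‖w j‖) ≤ distNearestInt (inner ℝ (w j) y) := by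
    intro ρ k c
    by_cases hρ : 0 < ρ
    · by_cases hk : k₀ ρ ≤ k
      · obtain ⟨j, rfl⟩ := Nat.exists_eq_add_of_le hk
        have hwj : w j ≠ 0 := fun h => by
          have := hw1 j
          rw [h, norm_zero, mul_zero] at this
          linarith
        obtain ⟨c', h1, h2⟩ := SchmidtGame.exists_move_avoiding_hyperplanes hα0 hα
          (by positivity : 0 < (α * β) ^ (k₀ ρ + j) * ρ) hwj (by
            calc (α * β) ^ (k₀ ρ + j) * ρ * ‖w j‖
                = (α * β) ^ k₀ ρ * ρ * ((α * β) ^ j * ‖w j‖) := by ring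
              _ ≤ (α * β) ^ k₀ ρ * ρ * n := by gcongr; exact hw2 j
              _ ≤ 1 / 4 := hk₀ ρ hρ) c
        refine ⟨c', fun _ => ⟨h1, fun j' hj' => ?_⟩⟩
        obtain rfl : j = j' := by omega
        exact h2
      · refine ⟨c, fun _ => ⟨?_, fun j hj => absurd hj (by omega)⟩⟩
        rw [dist_self]
        exact mul_nonneg (by linarith) (by positivity)
    · exact ⟨c, fun h => absurd h hρ⟩
  choose f hf using hmove
  refine SchmidtGame.isWinningFor_of_move hα0 (by linarith) hβ0 hβ1 f
    (fun ρ hρ k c => (hf ρ k c hρ).1) fun ρ hρ b η hη => ?_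
  have h2α : 0 < 1 - 2 * α := by linarith
  refine mem_badAffine_of_le_distNearestInt hm hn Θ (by linarith : 1 < (α * β)⁻¹)
    (by positivity : 0 < (1 - 2 * α) * ((α * β) ^ k₀ ρ * ρ * (α * β))) hv2 hdir η fun j => ?_
  have h := (hf ρ (k₀ ρ + j) (b (k₀ ρ + j)) hρ).2 j rfl η (hη _)
  have hinner : inner ℝ (w j) η = ∑ a, (v j a : ℝ) * η a := by
    simp [w, PiLp.inner_apply, mul_comm]
  rw [hinner] at h
  refine le_trans ?_ h
  calc (1 - 2 * α) * ((α * β) ^ k₀ ρ * ρ * (α * β))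
      ≤ (1 - 2 * α) * ((α * β) ^ k₀ ρ * ρ * ((α * β) ^ j * ‖w j‖)) := by
        have hwj := (hw1 j).le
        set t := (α * β) ^ j * ‖w j‖
        set q := α * β
        gcongr
    _ = (1 - 2 * α) * ((α * β) ^ (k₀ ρ + j) * ρ * ‖w j‖) := by ring
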